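/- Let $M$ be a compact smooth $n$-dimensional Riemannian manifold with metric $g$, possibly with (smooth) boundary $\partial M$, and let $dV$ denote its Riemannian volume. Let $\nu : M \to \mathbb{R}_{>0}$ be a strictly positive continuous probability density, i.e. $\int_M \nu \, dV = 1$. Let $u$ be a smooth vector field on $M$, let $$\operatorname{div}(u) = \sum_{i=1}^n \langle \nabla_{e_i} u, e_i\rangle_g$$ be its Riemannian divergence, where $\nabla$ is the Levi-Civita covariant derivative and $(e_i)_{i=1}^n$ is an orthonormal basis of the tangent space at the point considered, and put $\bar\mu = \nu - \operatorname{div}(u)$. If $\partial M = \emptyset$, or if $u$ is tangent to the boundary, i.e. $u(x) \in T_x \partial M$ for every $x \in \partial M$, then $$\int_M \bar\mu \, dV = 1 .$$ -/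

import Mathlib

open MeasureTheory Set Topology
open scoped Manifold ContDiff Bundle

namespace MoserFlow

noncomputable section

variable {n : ℕ} {H : Type*} [TopologicalSpace H]
  (I : ModelWithCorners ℝ (EuclideanSpace ℝ (Fin n)) H)
  {M : Type*} [TopologicalSpace M] [ChartedSpace H M]

/-- The model `I` describes `n`-dimensional manifolds with (possibly empty) boundary, and no
corners: it is the whole space `ℝⁿ` or a closed half-space of it. In particular `𝓡 n` and `𝓡∂ n`
are of this kind. -/
def IsBoundaryModel : Prop :=
  range I = univ ∨
    ∃ l : EuclideanSpace ℝ (Fin n) →L[ℝ] ℝ, l ≠ 0 ∧ range I = {y | 0 ≤ l y}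

/-- The tangent vector `v` at `x` is tangent to the boundary of `M`: it is the velocity at time `0`
of a curve that stays in `∂M`. For `x ∈ ∂M` these vectors form the subspace `T_x ∂M` of `T_x M`. -/
def IsTangentToBoundary (x : M) (v : TangentSpace I x) : Prop :=
  ∃ γ : ℝ → M, (∀ᶠ t in 𝓝 (0 : ℝ), γ t ∈ I.boundary M) ∧
    MDifferentiableAt 𝓘(ℝ, ℝ) I γ 0 ∧
    (⟨γ 0, mfderiv 𝓘(ℝ, ℝ) I γ 0 (1 : ℝ)⟩ : TangentBundle I M) = ⟨x, v⟩

/-- The differential at `p` of the chart around `x₀`. -/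
def chartDeriv (x₀ p : M) : TangentSpace I p →L[ℝ] EuclideanSpace ℝ (Fin n) :=
  mfderiv I 𝓘(ℝ, EuclideanSpace ℝ (Fin n)) (extChartAt I x₀) p

/-- The tangent vector at `p` with a given coordinate vector in the chart around `x₀`; it sends the
standard basis vector `e_i` to the coordinate vector `∂_i` at `p`. -/
def ofCoord (x₀ p : M) : EuclideanSpace ℝ (Fin n) →L[ℝ] TangentSpace I p :=
  (chartDeriv I x₀ p).inverse

/-- The coordinate expression, in the chart around `x₀`, of a vector field `u` on `M`. -/
def fieldCoord (x₀ : M) (u : ∀ x : M, TangentSpace I x) (y : EuclideanSpace ℝ (Fin n)) :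
    EuclideanSpace ℝ (Fin n) :=
  chartDeriv I x₀ ((extChartAt I x₀).symm y) (u ((extChartAt I x₀).symm y))

section Metric

variable [Bundle.RiemannianBundle (fun x : M => TangentSpace I x)]

/-- The matrix `g_{ij} = ⟪∂_i, ∂_j⟫` of the Riemannian metric in the chart around `x₀`, at the
point with coordinates `y`. -/
def metricMatrix (x₀ : M) (y : EuclideanSpace ℝ (Fin n)) : Matrix (Fin n) (Fin n) ℝ :=
  Matrix.of fun i j =>
    inner ℝ (ofCoord I x₀ ((extChartAt I x₀).symm y) (EuclideanSpace.single i 1))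
      (ofCoord I x₀ ((extChartAt I x₀).symm y) (EuclideanSpace.single j 1))

/-- The partial derivative `∂_k g_{ij}` in the chart around `x₀`; it is taken within the range of
the model, so that it is meaningful at boundary points, too. -/
def metricPartial (x₀ : M) (y : EuclideanSpace ℝ (Fin n)) (k i j : Fin n) : ℝ :=
  fderivWithin ℝ (fun z => metricMatrix I x₀ z i j) (range I) y (EuclideanSpace.single k 1)

/-- The Christoffel symbol `Γ^k_{ij} = ½ ∑ₗ g^{kl} (∂_i g_{jl} + ∂_j g_{il} - ∂_l g_{ij})`
of the Levi-Civita connection in the chart around `x₀`. -/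
def christoffel (x₀ : M) (y : EuclideanSpace ℝ (Fin n)) (k i j : Fin n) : ℝ :=
  (1 / 2) * ∑ l : Fin n, (metricMatrix I x₀ y)⁻¹ k l *
    (metricPartial I x₀ y i j l + metricPartial I x₀ y j i l - metricPartial I x₀ y l i j)

/-- The Riemannian (Levi-Civita) covariant derivative `v ↦ ∇_v u` of the vector field `u` at `x`.
In the coordinates of the chart around `x`,
`(∇_v u)^k = ∑ᵢ v^i ∂_i u^k + ∑ᵢⱼ Γ^k_{ij} v^i u^j`. -/
def covariantDeriv (u : ∀ x : M, TangentSpace I x) (x : M) :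
    TangentSpace I x →ₗ[ℝ] TangentSpace I x :=
  (ofCoord I x x).toLinearMap ∘ₗ
    ((fderivWithin ℝ (fieldCoord I x u) (range I) (extChartAt I x x)).toLinearMap +
      Matrix.toEuclideanLin (Matrix.of fun k i : Fin n =>
        ∑ j : Fin n, christoffel I x (extChartAt I x x) k i j *
          fieldCoord I x u (extChartAt I x x) j)) ∘ₗ
    (chartDeriv I x x).toLinearMap

/-- The tangent spaces of `M` are finite-dimensional. -/
instance finiteDimensional_tangentSpace (x : M) : FiniteDimensional ℝ (TangentSpace I x) :=
  inferInstanceAs (FiniteDimensional ℝ (EuclideanSpace ℝ (Fin n)))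

/-- The Riemannian divergence `div u = ∑ᵢ ⟪∇_{e_i} u, e_i⟫`, where `(e_i)` is an orthonormal basis
of the tangent space. -/
def divergence (u : ∀ x : M, TangentSpace I x) (x : M) : ℝ :=
  ∑ i, inner ℝ (covariantDeriv I u x (stdOrthonormalBasis ℝ (TangentSpace I x) i))
    (stdOrthonormalBasis ℝ (TangentSpace I x) i)

/-- The divergence does not depend on the orthonormal basis. -/
theorem divergence_eq_sum {ι : Type*} [Fintype ι] (u : ∀ x : M, TangentSpace I x) (x : M)
    (b : OrthonormalBasis ι ℝ (TangentSpace I x)) :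
    divergence I u x = ∑ i, inner ℝ (covariantDeriv I u x (b i)) (b i) := by
  simp only [divergence, real_inner_comm _ (covariantDeriv I u x _)]
  rw [← LinearMap.trace_eq_sum_inner, ← LinearMap.trace_eq_sum_inner]

variable [MeasurableSpace M]

/-- The Riemannian volume of the domain of the chart around `x₀`, as a measure on `M` carried by
that domain: the image under the inverse chart of `√(det g) dy`. -/
def chartVolume (x₀ : M) : Measure M :=
  ((volume.restrict (extChartAt I x₀).target).withDensity
    (fun y => ENNReal.ofReal √(metricMatrix I x₀ y).det)).map (extChartAt I x₀).symm

variable (M)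

/-- The Riemannian volume measure on `M`: the least measure that dominates the Riemannian volume
of each chart domain. As these measures agree on overlaps and countably many chart domains
cover `M`, it is the measure that restricts to `√(det g) dy` on each chart domain. -/
def riemannianVolume : Measure M := ⨆ x₀ : M, chartVolume I x₀

end Metric

end

end MoserFlow

/-! Since `ν` has integral `1`, everything rests on the divergence theorem `∫ div u dV = 0`.

In a chart put `ρ = √(det g)`. Jacobi's formula gives `∂_j log ρ = ∑ₖ Γ^k_{kj}`, so the trace of
`∇u` is `∑ᵢ ∂_i u^i + u(log ρ)`, and `ρ div u` is the Euclidean divergence of `ρ u`. The divergence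
at `x` is defined by the chart around `x`, which may jump with `x`. Hence the expression `tr Dw +
DL(w)` must be shown invariant under coordinate changes
(`trace_fderivWithin_add_eq_of_coordChange`). Afterwards one fixed chart serves all points of its
domain (`divergence_eq_chartDivergence`).

A finite smooth partition of unity reduces the claim to a field supported in one chart domain, and
the volume there is `ρ dy`. Extended by zero, `ρ u` is a compactly supported `C¹` field `X` on `ℝⁿ`
or on a half-space `0 ≤ l`. On `ℝⁿ` each partial derivative integrates to zero. On the half-space,
multiply `X` by cutoffs that vanish where `l < 1/k`. The error term is `k χ'(k l - 1) l(X)`.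
Tangency gives `|l(X)| ≤ C l`, so this term is bounded uniformly in `k`, and it tends to zero
pointwise in the interior; dominated convergence concludes. -/

/-! ### Derivatives of determinants and invariance of the divergence -/

/-- **Jacobi's formula** for the derivative of a determinant. -/
theorem Matrix.hasFDerivWithinAt_det {E ι : Type*} [NormedAddCommGroup E] [NormedSpace ℝ E]
    [Fintype ι] [DecidableEq ι] {s : Set E} {y : E} {A : E → Matrix ι ι ℝ}
    {A' : ι → ι → E →L[ℝ] ℝ} (hA : ∀ i j, HasFDerivWithinAt (fun z => A z i j) (A' i j) s y) :
    HasFDerivWithinAt (fun z => (A z).det)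
      (∑ j, ∑ i, (A y).adjugate j i • A' i j) s y := by
  have h1 : HasFDerivWithinAt (fun z => (A z).det)
      (∑ σ : Equiv.Perm ι, ((Equiv.Perm.sign σ : ℤ) : ℝ) •
        ∑ j, (∏ k ∈ Finset.univ.erase j, A y (σ k) k) • A' (σ j) j) s y := by
    simp only [Matrix.det_apply']
    refine HasFDerivWithinAt.fun_sum fun σ _ => HasFDerivWithinAt.const_mul ?_ _
    exact HasFDerivWithinAt.finsetProd fun i _ => hA (σ i) i
  convert h1 using 1
  ext v
  simp only [FunLike.coe_sum, Finset.sum_apply, FunLike.coe_smul, Pi.smul_apply, smul_eq_mul,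
    Finset.mul_sum]
  rw [Finset.sum_comm (s := Finset.univ (α := Equiv.Perm ι))]
  refine Finset.sum_congr rfl fun j _ => ?_
  -- Cramer's rule: pairing row `j` of the adjugate with a vector gives the determinant with column
  -- `j` replaced by that vector.
  have h2 : ∑ i, (A y).adjugate j i * A' i j v = ((A y).updateCol j fun i => A' i j v).det := by
    rw [← Matrix.cramer_apply, Matrix.cramer_eq_adjugate_mulVec]
    rfl
  rw [h2, Matrix.det_apply']
  refine Finset.sum_congr rfl fun σ _ => ?_
  rw [← Finset.mul_prod_erase _ _ (Finset.mem_univ j)]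
  simp only [Matrix.updateCol_self]
  rw [mul_comm (A' _ _ _)]
  congr 2
  refine Finset.prod_congr rfl fun k hk => ?_
  rw [Matrix.updateCol_ne (Finset.ne_of_mem_erase hk)]

/-- The derivative of the logarithm of a determinant. -/
theorem Matrix.hasFDerivWithinAt_log_det {E ι : Type*} [NormedAddCommGroup E] [NormedSpace ℝ E]
    [Fintype ι] [DecidableEq ι] {s : Set E} {y : E} {A : E → Matrix ι ι ℝ}
    {A' : ι → ι → E →L[ℝ] ℝ} (hA : ∀ i j, HasFDerivWithinAt (fun z => A z i j) (A' i j) s y)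
    (hdet : (A y).det ≠ 0) :
    HasFDerivWithinAt (fun z => Real.log (A z).det)
      (∑ j, ∑ i, (A y)⁻¹ j i • A' i j) s y := by
  have h := (Matrix.hasFDerivWithinAt_det hA).log hdet
  convert h using 1
  ext v
  simp [Matrix.inv_def, Finset.mul_sum, mul_assoc]

/-- The derivative of the logarithm of the determinant of a linear endomorphism. -/
theorem HasFDerivWithinAt.log_det {E F : Type*} [NormedAddCommGroup E] [NormedSpace ℝ E]
    [NormedAddCommGroup F] [NormedSpace ℝ F] [FiniteDimensional ℝ F]
    {s : Set E} {y : E} {A : E → F →L[ℝ] F}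
    {A' : E →L[ℝ] F →L[ℝ] F} (hA : HasFDerivWithinAt A A' s y) (hinv : (A y).IsInvertible) :
    ∃ D : E →L[ℝ] ℝ, HasFDerivWithinAt (fun z => Real.log (A z).det) D s y ∧
      ∀ v, D v = LinearMap.trace ℝ F ((A y).inverse ∘L A' v).toLinearMap := by
  classical
  let b := Module.finBasis ℝ F
  let m : (F →L[ℝ] F) →ₗ[ℝ] Matrix _ _ ℝ :=
    (LinearMap.toMatrix b b).toLinearMap ∘ₗ ContinuousLinearMap.coeLM ℝ
  have hm : ∀ B : F →L[ℝ] F, m B = LinearMap.toMatrix b b B.toLinearMap := fun B => rfl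
  have hmul : ∀ B C : F →L[ℝ] F, m (B ∘L C) = m B * m C := fun B C => by
    simp only [hm]
    exact LinearMap.toMatrix_comp b b b _ _
  have hone : m (ContinuousLinearMap.id ℝ F) = 1 := by
    simp [hm]
  have hdet : ∀ B : F →L[ℝ] F, B.det = (m B).det := fun B => by
    rw [hm, LinearMap.det_toMatrix]
  let e : Fin _ → Fin _ → (F →L[ℝ] F) →L[ℝ] ℝ := fun i j =>
    LinearMap.toContinuousLinearMap (Matrix.entryLinearMap ℝ ℝ i j ∘ₗ m)
  have he : ∀ i j B, e i j B = m B i j := fun i j B => rfl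
  have hi1 : m (A y).inverse * m (A y) = 1 := by
    rw [← hmul, ← hone]; congr 1
    ext v; simp [hinv]
  have hinv' : (m (A y))⁻¹ = m (A y).inverse := Matrix.inv_eq_left_inv hi1
  have hne : (m (A y)).det ≠ 0 := by
    intro h0
    have := congrArg Matrix.det hi1
    simp [h0] at this
  have hD := Matrix.hasFDerivWithinAt_log_det (A := fun z => m (A z))
    (A' := fun i j => e i j ∘L A') (s := s) (y := y)
    (fun i j => (e i j).hasFDerivAt.comp_hasFDerivWithinAt y hA) hne
  refine ⟨_, by simpa only [hdet] using hD, ?_⟩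
  · intro v
    rw [LinearMap.trace_eq_matrix_trace ℝ b, ← hm, hmul, hinv']
    simp [Matrix.trace, Matrix.mul_apply, he]

/-- The expression `tr Dw + DL(w)`, that is the divergence of `w` relative to the density `exp L`,
is invariant under changes of coordinates. -/
theorem trace_fderivWithin_add_eq_of_coordChange {E : Type*} [NormedAddCommGroup E]
    [NormedSpace ℝ E] [FiniteDimensional ℝ E] {s : Set E} (hs : UniqueDiffOn ℝ s) {y : E}
    (hy : y ∈ s) (hy' : y ∈ closure (interior s)) {τ : E → E} (hτ : ContDiffWithinAt ℝ 2 τ s y)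
    (hinv : (fderivWithin ℝ τ s y).IsInvertible) (hmaps : ∀ᶠ z in 𝓝[s] y, τ z ∈ s)
    {w w' : E → E} (hw : DifferentiableWithinAt ℝ w s y)
    (hw' : DifferentiableWithinAt ℝ w' s (τ y))
    (hww' : ∀ᶠ z in 𝓝[s] y, w' (τ z) = fderivWithin ℝ τ s z (w z))
    {L L' : E → ℝ} (hL' : DifferentiableWithinAt ℝ L' s (τ y))
    (hLL' : ∀ᶠ z in 𝓝[s] y, L z = L' (τ z) + Real.log (fderivWithin ℝ τ s z).det) :
    LinearMap.trace ℝ E (fderivWithin ℝ w' s (τ y)).toLinearMap +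
        fderivWithin ℝ L' s (τ y) (w' (τ y)) =
      LinearMap.trace ℝ E (fderivWithin ℝ w s y).toLinearMap + fderivWithin ℝ L s y (w y) := by
  have hu := hs y hy
  have hτ1 : HasFDerivWithinAt τ (fderivWithin ℝ τ s y) s y :=
    (hτ.differentiableWithinAt (by norm_num)).hasFDerivWithinAt
  have htend : Filter.Tendsto τ (𝓝[s] y) (𝓝[s] (τ y)) :=
    tendsto_nhdsWithin_iff.2 ⟨hτ1.continuousWithinAt, hmaps⟩
  have hA : HasFDerivWithinAt (fderivWithin ℝ τ s) (fderivWithin ℝ (fderivWithin ℝ τ s) s y) s y :=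
    ((hτ.fderivWithin_right hs (m := 1) (by norm_num) hy).differentiableWithinAt
      (by norm_num)).hasFDerivWithinAt
  have hsymm : IsSymmSndFDerivWithinAt ℝ τ s y :=
    hτ.isSymmSndFDerivWithinAt (by simp) hs hy' hy
  set A := fderivWithin ℝ τ s with hAdef
  set A' := fderivWithin ℝ A s y with hA'def
  obtain ⟨D, hD, hDv⟩ := hA.log_det hinv
  -- Both sides are the derivative of `w' ∘ τ = Dτ · w`, by the chain rule and by the product rule.
  have e1 : (fderivWithin ℝ w' s (τ y)) ∘L A y = A y ∘L fderivWithin ℝ w s y + A'.flip (w y) := by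
    refine hu.eq (hw'.hasFDerivWithinAt.comp_of_tendsto y hτ1 htend) ?_
    refine (hA.clm_apply hw.hasFDerivWithinAt).congr_of_eventuallyEq hww' ?_
    exact hww'.self_of_nhdsWithin hy
  have e2 : fderivWithin ℝ L s y = (fderivWithin ℝ L' s (τ y)) ∘L A y + D := by
    refine HasFDerivWithinAt.fderivWithin ?_ hu
    refine ((hL'.hasFDerivWithinAt.comp_of_tendsto y hτ1 htend).add hD).congr_of_eventuallyEq
      hLL' ?_
    exact hLL'.self_of_nhdsWithin hy
  -- Symmetry of the second derivative of `τ` turns the extra term into the derivative of the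
  -- Jacobian along `w`. Its trace against `(A y)⁻¹` is `D (w y)`, which cancels the change of `L`.
  have e3 : A'.flip (w y) = A' (w y) := by
    ext v
    exact hsymm v (w y)
  have e4 : w' (τ y) = A y (w y) := hww'.self_of_nhdsWithin hy
  have e5 : LinearMap.trace ℝ E (fderivWithin ℝ w' s (τ y)).toLinearMap =
      LinearMap.trace ℝ E (fderivWithin ℝ w s y).toLinearMap + D (w y) := by
    have hl : (A y).inverse ∘L A y = ContinuousLinearMap.id ℝ E := by ext v; simp [hinv]
    have hr : A y ∘L (A y).inverse = ContinuousLinearMap.id ℝ E := by ext v; simp [hinv]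
    have h6 : (fderivWithin ℝ w' s (τ y)) =
        ((fderivWithin ℝ w' s (τ y)) ∘L A y) ∘L (A y).inverse := by
      rw [ContinuousLinearMap.comp_assoc, hr, ContinuousLinearMap.comp_id]
    have h7 := LinearMap.trace_mul_comm ℝ ((A y).inverse).toLinearMap
      ((fderivWithin ℝ w' s (τ y)) ∘L A y).toLinearMap
    have h8 : (A y).inverse ∘L ((fderivWithin ℝ w' s (τ y)) ∘L A y) =
        fderivWithin ℝ w s y + (A y).inverse ∘L A' (w y) := by
      rw [e1, e3, ContinuousLinearMap.comp_add, ← ContinuousLinearMap.comp_assoc, hl,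
        ContinuousLinearMap.id_comp]
    rw [h6]
    refine h7.symm.trans ?_
    rw [hDv, ← map_add]
    exact congrArg (fun B : E →L[ℝ] E => LinearMap.trace ℝ E B.toLinearMap) h8
  rw [e5, e2, e4]
  simp only [add_apply, ContinuousLinearMap.comp_apply]
  ring

/-! ### The divergence theorem on a vector space and on a half-space -/

section DivergenceTheorem

variable {E : Type*} [NormedAddCommGroup E] [NormedSpace ℝ E] [FiniteDimensional ℝ E]

/-- The trace as a continuous linear functional on the continuous endomorphisms. -/
noncomputable def traceCLM (E : Type*) [NormedAddCommGroup E] [NormedSpace ℝ E]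
    [FiniteDimensional ℝ E] : (E →L[ℝ] E) →L[ℝ] ℝ :=
  LinearMap.toContinuousLinearMap (LinearMap.trace ℝ E ∘ₗ ContinuousLinearMap.coeLM ℝ)

theorem traceCLM_apply (A : E →L[ℝ] E) : traceCLM E A = LinearMap.trace ℝ E A.toLinearMap := rfl

theorem traceCLM_smulRight (l : E →L[ℝ] ℝ) (v : E) : traceCLM E (l.smulRight v) = l v := by
  rw [traceCLM_apply]
  exact LinearMap.trace_smulRight l.toLinearMap v

variable [MeasurableSpace E] [BorelSpace E] {μ : Measure E} [μ.IsAddHaarMeasure]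

/-- A `C¹` vector field with compact support has divergence of integral zero. -/
theorem integral_trace_fderiv_eq_zero {X : E → E} (hX : ContDiff ℝ 1 X)
    (hc : HasCompactSupport X) : ∫ y, traceCLM E (fderiv ℝ X y) ∂μ = 0 := by
  let b := Module.finBasis ℝ E
  have hint : Integrable (fderiv ℝ X) μ :=
    (hX.continuous_fderiv (by norm_num)).integrable_of_hasCompactSupport (hc.fderiv ℝ)
  have hz : ∀ v : E, ∫ y, fderiv ℝ X y v ∂μ = 0 := fun v => by
    -- Integration by parts against the constant function `1`.
    have h := integral_smul_fderiv_eq_neg_fderiv_smul_of_integrable (μ := μ) (𝕜 := ℝ)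
      (f := fun _ : E => (1 : ℝ)) (g := X) (v := v) (by simp)
      (by simpa using hint.apply_continuousLinearMap v)
      (by simpa using hX.continuous.integrable_of_hasCompactSupport hc)
      (fun x _ => differentiableAt_const _)
      (fun x _ => (hX.differentiable (by norm_num)) x)
    simpa using h
  have h0 : ∫ y, fderiv ℝ X y ∂μ = 0 := by
    ext v
    rw [ContinuousLinearMap.integral_apply hint, hz]
    rfl
  rw [(traceCLM E).integral_comp_comm hint, h0, map_zero]

theorem deriv_smoothTransition_of_neg {t : ℝ} (ht : t < 0) :
    deriv Real.smoothTransition t = 0 := by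
  have : Real.smoothTransition =ᶠ[𝓝 t] fun _ => 0 := by
    filter_upwards [Iio_mem_nhds ht] with z hz
    exact Real.smoothTransition.zero_of_nonpos (le_of_lt hz)
  rw [this.deriv_eq, deriv_const]

theorem deriv_smoothTransition_of_one_lt {t : ℝ} (ht : 1 < t) :
    deriv Real.smoothTransition t = 0 := by
  have : Real.smoothTransition =ᶠ[𝓝 t] fun _ => 1 := by
    filter_upwards [Ioi_mem_nhds ht] with z hz
    exact Real.smoothTransition.one_of_one_le (le_of_lt hz)
  rw [this.deriv_eq, deriv_const]

/-- With `t = k * l y - 1` the left side is `k * l y * χ'(k * l y - 1)`, so the bound is uniform in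
the cutoff parameter `k`. It holds because `χ'` is continuous and vanishes outside `[0, 1]`. -/
theorem exists_abs_mul_deriv_smoothTransition_le :
    ∃ C, ∀ t : ℝ, |(t + 1) * deriv Real.smoothTransition t| ≤ C := by
  have hcont : Continuous fun t : ℝ => (t + 1) * deriv Real.smoothTransition t :=
    (continuous_id.add continuous_const).mul
      ((Real.smoothTransition.contDiff (n := 1)).continuous_deriv (by norm_num))
  obtain ⟨C, hC⟩ := isCompact_Icc.exists_bound_of_continuousOn (s := Icc (0 : ℝ) 1)
    hcont.continuousOn
  refine ⟨max C 0, fun t => ?_⟩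
  by_cases ht : t ∈ Icc (0 : ℝ) 1
  · exact (hC t ht).trans (le_max_left _ _)
  · have : deriv Real.smoothTransition t = 0 := by
      rcases not_and_or.1 ht with h | h
      · exact deriv_smoothTransition_of_neg (not_le.1 h)
      · exact deriv_smoothTransition_of_one_lt (not_le.1 h)
    simp [this]

/-- A `C¹` vector field on a closed half-space that has compact support and is tangent to the
boundary has divergence of integral zero. -/
theorem setIntegral_halfSpace_trace_fderivWithin_eq_zero {l : E →L[ℝ] ℝ} (hl : l ≠ 0) {X : E → E}
    (hX : ContDiffOn ℝ 1 X {y | 0 ≤ l y}) {K : Set E} (hK : IsCompact K)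
    (hXK : ∀ y, y ∉ K → X y = 0) (hb : ∀ y, l y = 0 → l (X y) = 0) :
    ∫ y in {y | 0 ≤ l y}, traceCLM E (fderivWithin ℝ X {y | 0 ≤ l y} y) ∂μ = 0 := by
  set s : Set E := {y | 0 ≤ l y} with hs
  obtain ⟨w, hw⟩ : ∃ w, l w ≠ 0 := by
    by_contra! h
    exact hl (ContinuousLinearMap.ext h)
  have hsconv : Convex ℝ s := convex_halfSpace_ge l.isLinear 0
  have hsclosed : IsClosed s := isClosed_le continuous_const l.continuous
  have hsint : ∀ y, 0 < l y → s ∈ 𝓝 y := fun y hy =>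
    Filter.mem_of_superset ((isOpen_lt continuous_const l.continuous).mem_nhds hy)
      fun z hz => show 0 ≤ l z from le_of_lt hz
  have hsu : UniqueDiffOn ℝ s := by
    refine uniqueDiffOn_convex hsconv ⟨(l w)⁻¹ • w, ?_⟩
    rw [mem_interior_iff_mem_nhds]
    exact hsint _ (by simp [hw])
  have hDcont : ContinuousOn (fderivWithin ℝ X s) s :=
    hX.continuousOn_fderivWithin hsu (by norm_num)
  have hDK : ∀ y, y ∉ K → fderivWithin ℝ X s y = 0 := fun y hy => by
    have : X =ᶠ[𝓝[s] y] fun _ => 0 := by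
      filter_upwards [nhdsWithin_le_nhds (hK.isClosed.isOpen_compl.mem_nhds hy)] with z hz
      exact hXK z hz
    rw [this.fderivWithin_eq (hXK y hy)]
    simp
  obtain ⟨B, hB⟩ : ∃ B, ∀ y ∈ s, ‖fderivWithin ℝ X s y‖ ≤ B := by
    obtain ⟨B, hB⟩ := (hK.inter_right hsclosed).exists_bound_of_continuousOn
      (hDcont.mono inter_subset_right)
    refine ⟨max B 0, fun y hy => ?_⟩
    by_cases hyK : y ∈ K
    · exact (hB y ⟨hyK, hy⟩).trans (le_max_left _ _)
    · simp [hDK y hyK]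
  have hB0 : 0 ≤ B := (norm_nonneg _).trans (hB 0 (by simp [hs]))
  -- the normal component vanishes to first order at the boundary
  obtain ⟨C, hC0, hC⟩ : ∃ C, 0 ≤ C ∧ ∀ y ∈ s, |l (X y)| ≤ C * l y := by
    refine ⟨‖l‖ * (B * ‖(l w)⁻¹ • w‖), by positivity, fun y hy => ?_⟩
    -- The projection of `y` to the boundary hyperplane along `w`. There `l ∘ X` vanishes, and the
    -- mean value inequality on the segment to `y` gives a bound linear in `l y`.
    set y₀ := y - l y • (l w)⁻¹ • w with hy₀
    have hly₀ : l y₀ = 0 := by simp [hy₀, hw]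
    have h1 := hsconv.norm_image_sub_le_of_norm_fderivWithin_le
      (hX.differentiableOn (by norm_num)) hB (x := y₀) (y := y) (by simp [hs, hly₀]) hy
    have h2 : y - y₀ = l y • (l w)⁻¹ • w := by simp [hy₀]
    have h3 : l (X y) = l (X y - X y₀) := by rw [map_sub, hb y₀ hly₀, sub_zero]
    rw [h3]
    refine (l.le_opNorm _).trans ?_
    rw [h2, norm_smul, Real.norm_of_nonneg hy] at h1
    calc ‖l‖ * ‖X y - X y₀‖ ≤ ‖l‖ * (B * (l y * ‖(l w)⁻¹ • w‖)) := by gcongr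
      _ = _ := by ring
  obtain ⟨S, hS⟩ := exists_abs_mul_deriv_smoothTransition_le
  -- The cutoff is `0` where `l y ≤ 1 / k` and `1` where `l y ≥ 2 / k`, for `k > 0`. Hence `c k • X`
  -- is `C¹` on all of `E`, whatever values `X` takes outside the half-space.
  let c : ℕ → E → ℝ := fun k y => Real.smoothTransition (k * l y - 1)
  let Y : ℕ → E → E := fun k y => c k y • X y
  let D : ℕ → E → E →L[ℝ] E := fun k y => c k y • fderivWithin ℝ X s y +
    ((deriv Real.smoothTransition (k * l y - 1) * k) • l).smulRight (X y)
  have hczero : ∀ (k : ℕ) y, (k : ℝ) * l y < 1 → c k y = 0 := fun k y hy =>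
    Real.smoothTransition.zero_of_nonpos (by linarith)
  have hlt : ∀ (k : ℕ) y, ¬ 0 < l y → (k : ℝ) * l y < 1 := fun k y hy => by
    have : (k : ℝ) * l y ≤ 0 := mul_nonpos_of_nonneg_of_nonpos (by positivity) (not_lt.1 hy)
    linarith
  have hYzero : ∀ k y, ¬ 0 < l y → Y k =ᶠ[𝓝 y] fun _ => 0 := fun k y hy => by
    filter_upwards [(isOpen_lt (continuous_const.mul l.continuous) continuous_const).mem_nhds
      (hlt k y hy)] with z hz
    simp [Y, hczero k z hz]
  have hcsm : ∀ k, ContDiff ℝ 1 (c k) := fun k =>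
    (Real.smoothTransition.contDiff (n := 1)).comp
      ((contDiff_const.mul l.contDiff).sub contDiff_const)
  have hYsm : ∀ k, ContDiff ℝ 1 (Y k) := fun k => by
    rw [contDiff_iff_contDiffAt]
    intro y
    by_cases hy : 0 < l y
    · exact (hcsm k).contDiffAt.smul (hX.contDiffAt (hsint y hy))
    · exact contDiffAt_const.congr_of_eventuallyEq (hYzero k y hy)
  have hYc : ∀ k, HasCompactSupport (Y k) := fun k =>
    HasCompactSupport.intro hK fun y hy => by simp [Y, hXK y hy]
  have hYD : ∀ k y, fderiv ℝ (Y k) y = D k y := fun k y => by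
    by_cases hy : 0 < l y
    · have hc : HasFDerivAt (c k) ((deriv Real.smoothTransition (k * l y - 1) * k) • l) y := by
        have h1 : HasFDerivAt (fun y => (k : ℝ) * l y - 1) ((k : ℝ) • l) y :=
          (l.hasFDerivAt.const_mul (k : ℝ)).sub_const 1
        have h2 := ((Real.smoothTransition.contDiff (n := 1)).differentiable (by norm_num)
          ((k : ℝ) * l y - 1)).hasDerivAt.comp_hasFDerivAt y h1
        rwa [smul_smul] at h2
      have hXd : HasFDerivAt X (fderivWithin ℝ X s y) y :=
        ((hX.differentiableOn (by norm_num)) y (le_of_lt hy)).hasFDerivWithinAt.hasFDerivAt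
          (hsint y hy)
      exact (hc.smul hXd).fderiv
    · rw [(hYzero k y hy).fderiv_eq]
      have := hlt k y hy
      simp [D, hczero k y this, deriv_smoothTransition_of_neg
        (show (k : ℝ) * l y - 1 < 0 by linarith)]
  have htr : ∀ k y, traceCLM E (D k y) = c k y * traceCLM E (fderivWithin ℝ X s y) +
      deriv Real.smoothTransition (k * l y - 1) * k * l (X y) := fun k y => by
    simp only [D, map_add, map_smul, traceCLM_smulRight]
    simp
  have hint0 : ∀ k, ∫ y in s, traceCLM E (D k y) ∂μ = 0 := fun k => by
    rw [setIntegral_eq_integral_of_forall_compl_eq_zero]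
    · simp only [← hYD]
      exact integral_trace_fderiv_eq_zero (hYsm k) (hYc k)
    · intro y hy
      rw [← hYD, (hYzero k y fun h => hy (le_of_lt h)).fderiv_eq]
      simp
  have hlim : Filter.Tendsto (fun k => ∫ y in s, traceCLM E (D k y) ∂μ) Filter.atTop
      (𝓝 (∫ y in s, traceCLM E (fderivWithin ℝ X s y) ∂μ)) := by
    refine tendsto_integral_of_dominated_convergence
      (K.indicator fun _ => ‖traceCLM E‖ * B + S * C) (fun k => ?_) ?_ (fun k => ?_) ?_
    · simp only [← hYD]
      exact ((traceCLM E).continuous.comp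
        ((hYsm k).continuous_fderiv (by norm_num))).aestronglyMeasurable
    · exact ((integrable_indicator_iff hK.measurableSet).2
        (integrableOn_const hK.measure_lt_top.ne)).integrableOn
    · refine (ae_restrict_iff' hsclosed.measurableSet).2 (Filter.Eventually.of_forall fun y hy => ?_)
      by_cases hyK : y ∈ K
      · rw [indicator_of_mem hyK, htr]
        refine (norm_add_le _ _).trans (add_le_add ?_ ?_)
        · rw [norm_mul]
          calc ‖c k y‖ * ‖traceCLM E (fderivWithin ℝ X s y)‖ ≤ 1 * (‖traceCLM E‖ * B) := by
                gcongr
                · rw [Real.norm_of_nonneg (Real.smoothTransition.nonneg _)]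
                  exact Real.smoothTransition.le_one _
                · exact ((traceCLM E).le_opNorm _).trans
                    (mul_le_mul_of_nonneg_left (hB y hy) (norm_nonneg _))
            _ = _ := one_mul _
        -- The factor `k` from the cutoff is absorbed by the factor `l y` from `|l (X y)| ≤ C * l
        -- y`.
        · have h1 := hS (k * l y - 1)
          rw [sub_add_cancel, abs_mul, abs_mul, abs_of_nonneg (show 0 ≤ l y from hy)] at h1
          rw [Real.norm_eq_abs, abs_mul, abs_mul]
          calc _ ≤ |deriv Real.smoothTransition (k * l y - 1)| * |(k : ℝ)| * (C * l y) := by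
                gcongr; exact hC y hy
            _ = |(k : ℝ)| * l y * |deriv Real.smoothTransition (k * l y - 1)| * C := by ring
            _ ≤ S * C := by gcongr
      · rw [indicator_of_notMem hyK, htr, hDK y hyK, hXK y hyK]
        simp
    -- Pointwise convergence is needed only off the boundary hyperplane, a proper subspace. At an
    -- interior point the cutoff is locally constant `1` once `k > 2 / l y`.
    · have hnull : μ {y | l y = 0} = 0 := by
        have := Measure.addHaar_submodule μ (LinearMap.ker l.toLinearMap) (by
          intro h
          exact hw (LinearMap.mem_ker.1 (h ▸ Submodule.mem_top (x := w))))
        exact this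
      have hae : ∀ᵐ y ∂μ.restrict s, l y ≠ 0 :=
        ae_restrict_of_ae (by rw [ae_iff]; simpa using hnull)
      filter_upwards [hae, ae_restrict_mem hsclosed.measurableSet] with y hy0 hys
      have hpos : 0 < l y := lt_of_le_of_ne hys (Ne.symm hy0)
      refine tendsto_const_nhds.congr' ?_
      obtain ⟨N, hN⟩ := exists_nat_gt (2 / l y)
      filter_upwards [Filter.eventually_ge_atTop N] with k hk
      have h1 : 1 < (k : ℝ) * l y - 1 := by
        have : 2 < (k : ℝ) * l y := by
          rw [← div_lt_iff₀ hpos]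
          exact hN.trans_le (by exact_mod_cast hk)
        linarith
      rw [htr, deriv_smoothTransition_of_one_lt h1]
      have : c k y = 1 := Real.smoothTransition.one_of_one_le h1.le
      simp [this]
  refine tendsto_nhds_unique hlim ?_
  simp only [hint0]
  exact tendsto_const_nhds

end DivergenceTheorem

namespace MoserFlow

noncomputable section

/-! ### Charts, coordinate changes and vector fields in coordinates -/

section Charts

variable {n : ℕ} {H : Type*} [TopologicalSpace H]
  {I : ModelWithCorners ℝ (EuclideanSpace ℝ (Fin n)) H}
  {M : Type*} [TopologicalSpace M] [ChartedSpace H M]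

/-- The set of coordinates, in the chart around `x₀`, of the points that are also in the domain
of the chart around `x₁`. -/
def overlap (I : ModelWithCorners ℝ (EuclideanSpace ℝ (Fin n)) H) (x₀ x₁ : M) :
    Set (EuclideanSpace ℝ (Fin n)) :=
  (extChartAt I x₀).target ∩ (extChartAt I x₀).symm ⁻¹' (extChartAt I x₁).source

/-- The change of coordinates from the chart around `x₀` to the chart around `x₁`. -/
def transition (I : ModelWithCorners ℝ (EuclideanSpace ℝ (Fin n)) H) (x₀ x₁ : M) :
    EuclideanSpace ℝ (Fin n) → EuclideanSpace ℝ (Fin n) :=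
  extChartAt I x₁ ∘ (extChartAt I x₀).symm

theorem target_mem_nhdsWithin {x₀ : M} {y : EuclideanSpace ℝ (Fin n)}
    (hy : y ∈ (extChartAt I x₀).target) : (extChartAt I x₀).target ∈ 𝓝[range I] y :=
  extChartAt_target_mem_nhdsWithin_of_mem hy

theorem overlap_mem_nhdsWithin {x₀ x₁ : M} {y : EuclideanSpace ℝ (Fin n)}
    (hy : y ∈ overlap I x₀ x₁) : overlap I x₀ x₁ ∈ 𝓝[range I] y := by
  refine Filter.inter_mem (target_mem_nhdsWithin hy.1) ?_
  have hc : ContinuousWithinAt (extChartAt I x₀).symm (range I) y :=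
    ((continuousOn_extChartAt_symm x₀) y hy.1).mono_of_mem_nhdsWithin (target_mem_nhdsWithin hy.1)
  exact hc ((isOpen_extChartAt_source x₁).mem_nhds hy.2)

variable [IsManifold I ∞ M]

theorem chartDeriv_isInvertible {x₀ p : M} (hp : p ∈ (extChartAt I x₀).source) :
    (chartDeriv I x₀ p).IsInvertible :=
  isInvertible_mfderiv_extChartAt hp

theorem ofCoord_chartDeriv {x₀ p : M} (hp : p ∈ (extChartAt I x₀).source)
    (v : TangentSpace I p) : ofCoord I x₀ p (chartDeriv I x₀ p v) = v :=
  (chartDeriv_isInvertible hp).inverse_apply_self v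

theorem chartDeriv_ofCoord {x₀ p : M} (hp : p ∈ (extChartAt I x₀).source)
    (v : EuclideanSpace ℝ (Fin n)) : chartDeriv I x₀ p (ofCoord I x₀ p v) = v :=
  (chartDeriv_isInvertible hp).self_apply_inverse v

/-- Both maps invert the differential of the chart. In this form the chain rule computes the
derivative of a coordinate change. -/
theorem ofCoord_eq_mfderivWithin {x₀ : M} {y : EuclideanSpace ℝ (Fin n)}
    (hy : y ∈ (extChartAt I x₀).target) (v : EuclideanSpace ℝ (Fin n)) :
    ofCoord I x₀ ((extChartAt I x₀).symm y) v =
      mfderivWithin 𝓘(ℝ, EuclideanSpace ℝ (Fin n)) I (extChartAt I x₀).symm (range I) y v := by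
  have h := DFunLike.congr_fun
    (mfderiv_extChartAt_comp_mfderivWithin_extChartAt_symm (I := I) hy) v
  have h2 := ofCoord_chartDeriv (I := I) ((extChartAt I x₀).map_target hy)
    (mfderivWithin 𝓘(ℝ, EuclideanSpace ℝ (Fin n)) I (extChartAt I x₀).symm (range I) y v)
  rw [← h2]
  congr 1
  exact h.symm

theorem contDiffWithinAt_transition {x₀ x₁ : M} {y : EuclideanSpace ℝ (Fin n)}
    (hy : y ∈ overlap I x₀ x₁) : ContDiffWithinAt ℝ ∞ (transition I x₀ x₁) (range I) y :=
  contDiffWithinAt_ext_coord_change x₁ x₀ hy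

theorem fderivWithin_transition {x₀ x₁ : M} {y : EuclideanSpace ℝ (Fin n)}
    (hy : y ∈ overlap I x₀ x₁) (v : EuclideanSpace ℝ (Fin n)) :
    fderivWithin ℝ (transition I x₀ x₁) (range I) y v =
      chartDeriv I x₁ ((extChartAt I x₀).symm y) (ofCoord I x₀ ((extChartAt I x₀).symm y) v) := by
  rw [ofCoord_eq_mfderivWithin hy.1, ← mfderivWithin_eq_fderivWithin]
  have hp : (extChartAt I x₀).symm y ∈ (chartAt H x₁).source := by
    have := hy.2
    rwa [mem_preimage, extChartAt_source] at this
  have := mfderiv_comp_mfderivWithin (I := 𝓘(ℝ, EuclideanSpace ℝ (Fin n))) (I' := I)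
    (I'' := 𝓘(ℝ, EuclideanSpace ℝ (Fin n))) (f := (extChartAt I x₀).symm)
    (g := extChartAt I x₁) (s := range I) y (mdifferentiableAt_extChartAt hp)
    (mdifferentiableWithinAt_extChartAt_symm hy.1)
    (I.uniqueMDiffOn y (extChartAt_target_subset_range x₀ hy.1))
  exact DFunLike.congr_fun this v

/-- A vector field is smooth on a chart domain if and only if its coordinates are. -/
theorem contMDiffOn_iff_chartDeriv {x₀ : M} {u : ∀ x : M, TangentSpace I x} :
    ContMDiffOn I I.tangent ∞ (fun x => (⟨x, u x⟩ : TangentBundle I M)) (extChartAt I x₀).source ↔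
      ContMDiffOn I 𝓘(ℝ, EuclideanSpace ℝ (Fin n)) ∞ (fun p => chartDeriv I x₀ p (u p))
        (extChartAt I x₀).source := by
  have h := (trivializationAt (EuclideanSpace ℝ (Fin n)) (TangentSpace I)
    x₀).contMDiffOn_section_baseSet_iff (IB := I) (n := ∞) (s := u)
  rw [TangentBundle.trivializationAt_baseSet, ← extChartAt_source I] at h
  refine h.trans (contMDiffOn_congr fun p hp => ?_)
  have hp' : p ∈ (chartAt H x₀).source := by rwa [extChartAt_source] at hp
  have := TangentBundle.continuousLinearMapAt_trivializationAt (I := I) hp'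
  rw [chartDeriv, ← this]
  rw [Bundle.Trivialization.continuousLinearMapAt_apply,
    Bundle.Trivialization.linearMapAt_apply, if_pos]
  simpa using hp'

theorem contDiffOn_fieldCoord {x₀ : M} {u : ∀ x : M, TangentSpace I x}
    (hu : ContMDiffOn I I.tangent ∞ (fun x => (⟨x, u x⟩ : TangentBundle I M))
      (extChartAt I x₀).source) :
    ContDiffOn ℝ ∞ (fieldCoord I x₀ u) (extChartAt I x₀).target :=
  ((contMDiffOn_iff_chartDeriv.1 hu).comp (contMDiffOn_extChartAt_symm x₀)
    fun _ hy => (extChartAt I x₀).map_target hy).contDiffOn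

theorem contMDiffOn_ofCoord {x₀ : M} (v : EuclideanSpace ℝ (Fin n)) :
    ContMDiffOn I I.tangent ∞ (fun x => (⟨x, ofCoord I x₀ x v⟩ : TangentBundle I M))
      (extChartAt I x₀).source :=
  contMDiffOn_iff_chartDeriv.2
    (contMDiffOn_const.congr fun _ hp => chartDeriv_ofCoord hp v)

theorem fieldCoord_transition {x₀ x₁ : M} {y : EuclideanSpace ℝ (Fin n)}
    (hy : y ∈ overlap I x₀ x₁) (u : ∀ x : M, TangentSpace I x) :
    fieldCoord I x₁ u (transition I x₀ x₁ y) =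
      fderivWithin ℝ (transition I x₀ x₁) (range I) y (fieldCoord I x₀ u y) := by
  rw [fderivWithin_transition hy, fieldCoord, fieldCoord,
    ofCoord_chartDeriv ((extChartAt I x₀).map_target hy.1), transition, Function.comp_apply,
    (extChartAt I x₁).left_inv hy.2]

theorem isInvertible_fderivWithin_transition {x₀ x₁ : M} {y : EuclideanSpace ℝ (Fin n)}
    (hy : y ∈ overlap I x₀ x₁) :
    (fderivWithin ℝ (transition I x₀ x₁) (range I) y).IsInvertible := by
  have h : fderivWithin ℝ (transition I x₀ x₁) (range I) y =
      (chartDeriv I x₁ ((extChartAt I x₀).symm y)).comp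
        (ofCoord I x₀ ((extChartAt I x₀).symm y)) :=
    ContinuousLinearMap.ext fun v => fderivWithin_transition hy v
  rw [h]
  exact (chartDeriv_isInvertible hy.2).comp
    (chartDeriv_isInvertible ((extChartAt I x₀).map_target hy.1)).inverse

end Charts

/-! ### The metric matrix and the volume density in coordinates -/

section MetricCharts

variable {n : ℕ} {H : Type*} [TopologicalSpace H]
  {I : ModelWithCorners ℝ (EuclideanSpace ℝ (Fin n)) H}
  {M : Type*} [TopologicalSpace M] [ChartedSpace H M]
  [Bundle.RiemannianBundle (fun x : M => TangentSpace I x)]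

theorem inner_ofCoord (x₀ : M) (y v w : EuclideanSpace ℝ (Fin n)) :
    inner ℝ (ofCoord I x₀ ((extChartAt I x₀).symm y) v)
      (ofCoord I x₀ ((extChartAt I x₀).symm y) w) =
      ∑ k, ∑ l, v k * metricMatrix I x₀ y k l * w l := by
  have hv : ∀ v : EuclideanSpace ℝ (Fin n), v = ∑ k, v k • EuclideanSpace.single k (1 : ℝ) := by
    intro v
    simpa using ((EuclideanSpace.basisFun (Fin n) ℝ).sum_repr v).symm
  conv_lhs => rw [hv v, hv w]
  simp only [map_sum, map_smul, sum_inner, inner_sum, real_inner_smul_left, real_inner_smul_right]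
  rw [Finset.sum_comm]
  refine Finset.sum_congr rfl fun k _ => Finset.sum_congr rfl fun l _ => ?_
  rw [metricMatrix, Matrix.of_apply]
  ring

variable [IsManifold I ∞ M]

/-- It is the Gram matrix of the coordinate vectors, which are independent because the differential
of the chart inverts `ofCoord`. -/
theorem posDef_metricMatrix {x₀ : M} {y : EuclideanSpace ℝ (Fin n)}
    (hy : y ∈ (extChartAt I x₀).target) : (metricMatrix I x₀ y).PosDef := by
  have h : metricMatrix I x₀ y = Matrix.gram ℝ (fun i =>
    ofCoord I x₀ ((extChartAt I x₀).symm y) (EuclideanSpace.single i (1 : ℝ))) := rfl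
  rw [h, Matrix.posDef_gram_iff_linearIndependent]
  rw [Fintype.linearIndependent_iff]
  intro c hc i
  have h1 : ofCoord I x₀ ((extChartAt I x₀).symm y)
      (∑ i, c i • EuclideanSpace.single i (1 : ℝ)) = 0 := by
    rw [map_sum, ← hc]
    exact Finset.sum_congr rfl fun i _ => map_smul _ _ _
  have h2 := congrArg (chartDeriv I x₀ ((extChartAt I x₀).symm y)) h1
  rw [chartDeriv_ofCoord ((extChartAt I x₀).map_target hy), map_zero] at h2
  simpa [Finset.sum_apply, Pi.single_apply]
    using congrArg (fun v : EuclideanSpace ℝ (Fin n) => v i) h2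

/-- With `B` the Jacobian matrix of the coordinate change, `G₀ = Bᵀ G₁ B`. -/
theorem det_metricMatrix_transition {x₀ x₁ : M} {y : EuclideanSpace ℝ (Fin n)}
    (hy : y ∈ overlap I x₀ x₁) :
    (metricMatrix I x₀ y).det =
      (fderivWithin ℝ (transition I x₀ x₁) (range I) y).det ^ 2 *
        (metricMatrix I x₁ (transition I x₀ x₁ y)).det := by
  set T := fderivWithin ℝ (transition I x₀ x₁) (range I) y with hT
  let b := (EuclideanSpace.basisFun (Fin n) ℝ).toBasis
  set B := LinearMap.toMatrix b b T.toLinearMap with hB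
  have hBij : ∀ i j, B i j = T (EuclideanSpace.single j 1) i := by
    intro i j
    rw [hB, LinearMap.toMatrix_apply]
    simp [b]
  have hsym : (extChartAt I x₁).symm (transition I x₀ x₁ y) = (extChartAt I x₀).symm y := by
    rw [transition, Function.comp_apply, (extChartAt I x₁).left_inv hy.2]
  have hm : metricMatrix I x₀ y =
      B.transpose * metricMatrix I x₁ (transition I x₀ x₁ y) * B := by
    ext i j
    have h1 := inner_ofCoord (I := I) x₁ (transition I x₀ x₁ y)
      (T (EuclideanSpace.single i 1)) (T (EuclideanSpace.single j 1))
    rw [hsym, hT, fderivWithin_transition hy, fderivWithin_transition hy,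
      ofCoord_chartDeriv hy.2, ofCoord_chartDeriv hy.2, ← fderivWithin_transition hy,
      ← fderivWithin_transition hy, ← hT] at h1
    rw [metricMatrix, Matrix.of_apply, h1, Matrix.mul_apply, Finset.sum_comm]
    refine Finset.sum_congr rfl fun l _ => ?_
    rw [Matrix.mul_apply, Finset.sum_mul]
    refine Finset.sum_congr rfl fun k _ => ?_
    rw [Matrix.transpose_apply, hBij, hBij]
  have hd : T.det = B.det := by rw [hB, LinearMap.det_toMatrix]
  rw [hm, Matrix.det_mul, Matrix.det_mul, Matrix.det_transpose, hd]
  ring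

/-- The logarithm of the density `√(det g)` of the Riemannian volume in the chart around `x₀`. -/
def logDensity (I : ModelWithCorners ℝ (EuclideanSpace ℝ (Fin n)) H) {M : Type*}
    [TopologicalSpace M] [ChartedSpace H M]
    [Bundle.RiemannianBundle (fun x : M => TangentSpace I x)]
    (x₀ : M) (y : EuclideanSpace ℝ (Fin n)) : ℝ :=
  (1 / 2) * Real.log (metricMatrix I x₀ y).det

theorem sqrt_det_eq_exp {x₀ : M} {y : EuclideanSpace ℝ (Fin n)}
    (hy : y ∈ (extChartAt I x₀).target) :
    √(metricMatrix I x₀ y).det = Real.exp (logDensity I x₀ y) := by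
  rw [Real.sqrt_eq_rpow, Real.rpow_def_of_pos (posDef_metricMatrix hy).det_pos, logDensity]
  ring_nf

/-- `Real.log` ignores signs, so orientation-reversing coordinate changes need no separate
treatment. This is the hypothesis on `L` in the invariance of the divergence. -/
theorem logDensity_transition {x₀ x₁ : M} {y : EuclideanSpace ℝ (Fin n)}
    (hy : y ∈ overlap I x₀ x₁) :
    logDensity I x₀ y = logDensity I x₁ (transition I x₀ x₁ y) +
      Real.log (fderivWithin ℝ (transition I x₀ x₁) (range I) y).det := by
  have h1 := (posDef_metricMatrix (I := I) hy.1).det_pos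
  have h2 : transition I x₀ x₁ y ∈ (extChartAt I x₁).target := (extChartAt I x₁).map_source hy.2
  have h3 := (posDef_metricMatrix (I := I) h2).det_pos
  rw [det_metricMatrix_transition hy] at h1
  have h4 : (fderivWithin ℝ (transition I x₀ x₁) (range I) y).det ^ 2 ≠ 0 :=
    left_ne_zero_of_mul h1.ne'
  rw [logDensity, det_metricMatrix_transition hy, Real.log_mul h4 h3.ne', Real.log_pow, logDensity]
  push_cast
  ring

variable [IsContMDiffRiemannianBundle I ∞ (EuclideanSpace ℝ (Fin n))
  (fun x : M => TangentSpace I x)]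

theorem contDiffOn_metricMatrix (x₀ : M) (i j : Fin n) :
    ContDiffOn ℝ ∞ (fun y => metricMatrix I x₀ y i j) (extChartAt I x₀).target := by
  have h := (contMDiffOn_ofCoord (I := I) (x₀ := x₀) (EuclideanSpace.single i 1)).inner_bundle
    (contMDiffOn_ofCoord (I := I) (x₀ := x₀) (EuclideanSpace.single j 1))
  exact (h.comp (contMDiffOn_extChartAt_symm x₀)
    fun _ hy => (extChartAt I x₀).map_target hy).contDiffOn

theorem contDiffOn_det_metricMatrix (x₀ : M) :
    ContDiffOn ℝ ∞ (fun y => (metricMatrix I x₀ y).det) (extChartAt I x₀).target := by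
  simp only [Matrix.det_apply']
  exact ContDiffOn.sum fun σ _ => contDiffOn_const.mul
    (contDiffOn_prod fun i _ => contDiffOn_metricMatrix x₀ _ _)

theorem contDiffOn_logDensity (x₀ : M) :
    ContDiffOn ℝ ∞ (logDensity I x₀) (extChartAt I x₀).target :=
  contDiffOn_const.mul
    ((contDiffOn_det_metricMatrix x₀).log fun _ hy => (posDef_metricMatrix hy).det_pos.ne')

end MetricCharts

/-! ### The divergence in coordinates -/

section Divergence

variable {n : ℕ} {H : Type*} [TopologicalSpace H]
  {I : ModelWithCorners ℝ (EuclideanSpace ℝ (Fin n)) H}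
  {M : Type*} [TopologicalSpace M] [ChartedSpace H M]

theorem differentiableWithinAt_of_contDiffOn_target {F : Type*} [NormedAddCommGroup F]
    [NormedSpace ℝ F] {x₀ : M} {f : EuclideanSpace ℝ (Fin n) → F}
    (hf : ContDiffOn ℝ ∞ f (extChartAt I x₀).target) {y : EuclideanSpace ℝ (Fin n)}
    (hy : y ∈ (extChartAt I x₀).target) : DifferentiableWithinAt ℝ f (range I) y :=
  ((hf.differentiableOn (by simp)) y hy).mono_of_mem_nhdsWithin (target_mem_nhdsWithin hy)

variable [Bundle.RiemannianBundle (fun x : M => TangentSpace I x)]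

/-- The coordinate expression of the divergence in the chart around `x₀`. -/
def chartDivergence (I : ModelWithCorners ℝ (EuclideanSpace ℝ (Fin n)) H) {M : Type*}
    [TopologicalSpace M] [ChartedSpace H M]
    [Bundle.RiemannianBundle (fun x : M => TangentSpace I x)] (x₀ : M)
    (u : ∀ x : M, TangentSpace I x) (y : EuclideanSpace ℝ (Fin n)) : ℝ :=
  traceCLM _ (fderivWithin ℝ (fieldCoord I x₀ u) (range I) y) +
    fderivWithin ℝ (logDensity I x₀) (range I) y (fieldCoord I x₀ u y)

theorem metricMatrix_comm (x₀ : M) (y : EuclideanSpace ℝ (Fin n)) (i j : Fin n) :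
    metricMatrix I x₀ y i j = metricMatrix I x₀ y j i := by
  rw [metricMatrix, Matrix.of_apply, Matrix.of_apply, real_inner_comm]

theorem metricPartial_comm (x₀ : M) (y : EuclideanSpace ℝ (Fin n)) (k i j : Fin n) :
    metricPartial I x₀ y k i j = metricPartial I x₀ y k j i := by
  simp only [metricPartial, metricMatrix_comm x₀ _ i j]

theorem inv_metricMatrix_comm (x₀ : M) (y : EuclideanSpace ℝ (Fin n)) (i j : Fin n) :
    (metricMatrix I x₀ y)⁻¹ i j = (metricMatrix I x₀ y)⁻¹ j i := by
  have h : (metricMatrix I x₀ y).transpose = metricMatrix I x₀ y :=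
    Matrix.ext fun i j => metricMatrix_comm x₀ y j i
  conv_lhs => rw [← h, ← Matrix.transpose_nonsing_inv, Matrix.transpose_apply]

/-- In the contraction, the terms `∂_k g_{ml}` and `∂_l g_{km}` cancel, because `g⁻¹` is symmetric
in `k` and `l`. -/
theorem sum_christoffel (x₀ : M) (y : EuclideanSpace ℝ (Fin n)) (m : Fin n) :
    ∑ k, christoffel I x₀ y k k m =
      (1 / 2) * ∑ k, ∑ l, (metricMatrix I x₀ y)⁻¹ k l * metricPartial I x₀ y m k l := by
  have h : ∑ k, ∑ l, (metricMatrix I x₀ y)⁻¹ k l * metricPartial I x₀ y k m l =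
      ∑ k, ∑ l, (metricMatrix I x₀ y)⁻¹ k l * metricPartial I x₀ y l k m := by
    rw [Finset.sum_comm]
    refine Finset.sum_congr rfl fun k _ => Finset.sum_congr rfl fun l _ => ?_
    rw [inv_metricMatrix_comm, metricPartial_comm]
  simp only [christoffel, ← Finset.mul_sum, mul_add, mul_sub, Finset.sum_add_distrib,
    Finset.sum_sub_distrib, h]
  ring

theorem divergence_eq_trace (u : ∀ x : M, TangentSpace I x) (x : M) :
    divergence I u x = LinearMap.trace ℝ (TangentSpace I x) (covariantDeriv I u x) := by
  simp only [divergence, real_inner_comm _ (covariantDeriv I u x _)]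
  rw [← LinearMap.trace_eq_sum_inner]

variable [IsManifold I ∞ M]

/-- The covariant derivative is a coordinate endomorphism conjugated by the chart differential, so
cyclicity of the trace removes the conjugation. -/
theorem trace_covariantDeriv (u : ∀ x : M, TangentSpace I x) (x : M) :
    LinearMap.trace ℝ (TangentSpace I x) (covariantDeriv I u x) =
      traceCLM _ (fderivWithin ℝ (fieldCoord I x u) (range I) (extChartAt I x x)) +
        ∑ j, (∑ k, christoffel I x (extChartAt I x x) k k j) *
          fieldCoord I x u (extChartAt I x x) j := by
  have hx := mem_extChartAt_source (I := I) x
  have hid : (chartDeriv I x x).toLinearMap ∘ₗ (ofCoord I x x).toLinearMap = LinearMap.id :=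
    LinearMap.ext fun v => chartDeriv_ofCoord hx v
  rw [covariantDeriv, LinearMap.trace_comp_cycle, hid, LinearMap.comp_id, map_add, traceCLM_apply]
  congr 1
  rw [LinearMap.trace_eq_matrix_trace ℝ (EuclideanSpace.basisFun (Fin n) ℝ).toBasis,
    Matrix.toEuclideanLin_eq_toLin_orthonormal, LinearMap.toMatrix_toLin, Matrix.trace]
  simp only [Matrix.diag_apply, Matrix.of_apply, Finset.sum_mul]
  exact Finset.sum_comm

variable [IsContMDiffRiemannianBundle I ∞ (EuclideanSpace ℝ (Fin n))
  (fun x : M => TangentSpace I x)]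

/-- Jacobi's formula gives `½ ∑ g^{kl} ∂_m g_{kl}` for the derivative of `log √(det g)`, which is
the contracted Christoffel symbol. -/
theorem fderivWithin_logDensity {x₀ : M} {y : EuclideanSpace ℝ (Fin n)}
    (hy : y ∈ (extChartAt I x₀).target) (v : EuclideanSpace ℝ (Fin n)) :
    fderivWithin ℝ (logDensity I x₀) (range I) y v =
      ∑ j, (∑ k, christoffel I x₀ y k k j) * v j := by
  have hu := I.uniqueDiffOn y (extChartAt_target_subset_range x₀ hy)
  have h := (Matrix.hasFDerivWithinAt_log_det (A := metricMatrix I x₀) (fun i j =>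
    (differentiableWithinAt_of_contDiffOn_target
      (contDiffOn_metricMatrix x₀ i j) hy).hasFDerivWithinAt)
    (posDef_metricMatrix hy).det_pos.ne').const_mul (1 / 2)
  have hpart : ∀ i j, fderivWithin ℝ (fun z => metricMatrix I x₀ z i j) (range I) y v =
      ∑ m, v m * metricPartial I x₀ y m i j := fun i j => by
    have hv : v = ∑ k, v k • EuclideanSpace.single k (1 : ℝ) := by
      simpa using ((EuclideanSpace.basisFun (Fin n) ℝ).sum_repr v).symm
    conv_lhs => rw [hv]
    rw [map_sum]
    refine Finset.sum_congr rfl fun m _ => ?_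
    rw [map_smul, smul_eq_mul, metricPartial]
  have h2 : fderivWithin ℝ (logDensity I x₀) (range I) y = _ := h.fderivWithin hu
  rw [h2]
  simp only [FunLike.coe_sum, Finset.sum_apply, FunLike.coe_smul, Pi.smul_apply, smul_eq_mul,
    hpart, sum_christoffel, Finset.mul_sum, Finset.sum_mul]
  rw [Finset.sum_comm (s := Finset.univ (α := Fin n))]
  conv_rhs => rw [Finset.sum_comm]
  rw [Finset.sum_comm]
  refine Finset.sum_congr rfl fun i _ => ?_
  rw [Finset.sum_comm]
  conv_rhs => rw [Finset.sum_comm]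
  conv_lhs => rw [Finset.sum_comm]
  refine Finset.sum_congr rfl fun j _ => Finset.sum_congr rfl fun m _ => ?_
  rw [metricPartial_comm]
  ring

theorem divergence_eq_chartDivergence_self (u : ∀ x : M, TangentSpace I x) (x : M) :
    divergence I u x = chartDivergence I x u (extChartAt I x x) := by
  rw [divergence_eq_trace, trace_covariantDeriv, chartDivergence,
    fderivWithin_logDensity (mem_extChartAt_target x)]

/-- The Riemannian divergence can be computed in any chart. -/
theorem divergence_eq_chartDivergence {x₀ p : M} (hp : p ∈ (extChartAt I x₀).source)
    {u : ∀ x : M, TangentSpace I x}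
    (hu : ContMDiff I I.tangent ∞ (fun x => (⟨x, u x⟩ : TangentBundle I M))) :
    divergence I u p = chartDivergence I x₀ u (extChartAt I x₀ p) := by
  rw [divergence_eq_chartDivergence_self]
  set y := extChartAt I x₀ p with hy
  have hpy : (extChartAt I x₀).symm y = p := (extChartAt I x₀).left_inv hp
  have hyov : y ∈ overlap I x₀ p := by
    refine ⟨(extChartAt I x₀).map_source hp, ?_⟩
    rw [mem_preimage, hpy]
    exact mem_extChartAt_source p
  have hτ : transition I x₀ p y = extChartAt I p p := by
    rw [transition, Function.comp_apply, hpy]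
  have hyr : y ∈ range I := extChartAt_target_subset_range x₀ hyov.1
  have hτt : transition I x₀ p y ∈ (extChartAt I p).target := by
    rw [hτ]; exact mem_extChartAt_target p
  have hev := overlap_mem_nhdsWithin hyov
  have h := trace_fderivWithin_add_eq_of_coordChange I.uniqueDiffOn hyr
    (I.range_subset_closure_interior hyr)
    ((contDiffWithinAt_transition hyov).of_le ENat.LEInfty.out)
    (isInvertible_fderivWithin_transition hyov)
    (Filter.mem_of_superset hev fun z hz =>
      extChartAt_target_subset_range p ((extChartAt I p).map_source hz.2))
    (differentiableWithinAt_of_contDiffOn_target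
      (contDiffOn_fieldCoord (x₀ := x₀) hu.contMDiffOn) hyov.1)
    (differentiableWithinAt_of_contDiffOn_target
      (contDiffOn_fieldCoord (x₀ := p) hu.contMDiffOn) hτt)
    (Filter.mem_of_superset hev fun z hz => fieldCoord_transition hz u)
    (differentiableWithinAt_of_contDiffOn_target (contDiffOn_logDensity p) hτt)
    (Filter.mem_of_superset hev fun z hz => logDensity_transition hz)
  rw [hτ] at h
  exact h

/-- In coordinates, `√(det g) div u` is the Euclidean divergence of `√(det g) u`. -/
theorem trace_fderivWithin_sqrt_det_smul {x₀ : M} {u : ∀ x : M, TangentSpace I x}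
    (hu : ContMDiff I I.tangent ∞ (fun x => (⟨x, u x⟩ : TangentBundle I M)))
    {y : EuclideanSpace ℝ (Fin n)} (hy : y ∈ (extChartAt I x₀).target) :
    traceCLM _ (fderivWithin ℝ (fun z => Real.exp (logDensity I x₀ z) • fieldCoord I x₀ u z)
      (range I) y) = Real.exp (logDensity I x₀ y) * chartDivergence I x₀ u y := by
  have huq := I.uniqueDiffOn y (extChartAt_target_subset_range x₀ hy)
  have h1 := (differentiableWithinAt_of_contDiffOn_target
    (contDiffOn_logDensity (I := I) x₀) hy).hasFDerivWithinAt.exp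
  have h2 := (differentiableWithinAt_of_contDiffOn_target
      (contDiffOn_fieldCoord (x₀ := x₀) hu.contMDiffOn) hy).hasFDerivWithinAt
  have h3 := (h1.smul h2).fderivWithin huq
  refine (congrArg (traceCLM _) h3).trans ?_
  rw [map_add, map_smul, traceCLM_smulRight, chartDivergence]
  simp only [FunLike.coe_smul, Pi.smul_apply, smul_eq_mul]
  ring

theorem continuousOn_chartDivergence {x₀ : M} {u : ∀ x : M, TangentSpace I x}
    (hu : ContMDiff I I.tangent ∞ (fun x => (⟨x, u x⟩ : TangentBundle I M))) :
    ContinuousOn (chartDivergence I x₀ u) (extChartAt I x₀).target := by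
  have key : ∀ {F : Type} [NormedAddCommGroup F] [NormedSpace ℝ F]
      {f : EuclideanSpace ℝ (Fin n) → F}, ContDiffOn ℝ ∞ f (extChartAt I x₀).target →
      ContinuousOn (fderivWithin ℝ f (range I)) (extChartAt I x₀).target := by
    intro F _ _ f hf y hy
    have h := ((hf y hy).mono_of_mem_nhdsWithin (target_mem_nhdsWithin hy)).fderivWithin_right
      I.uniqueDiffOn (m := 0) (by simp) (extChartAt_target_subset_range x₀ hy)
    exact h.continuousWithinAt.mono (extChartAt_target_subset_range x₀)
  have hf := contDiffOn_fieldCoord (x₀ := x₀) hu.contMDiffOn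
  exact ((traceCLM _).continuous.comp_continuousOn (key hf)).add
    ((key (contDiffOn_logDensity x₀)).clm_apply hf.continuousOn)

theorem continuous_divergence {u : ∀ x : M, TangentSpace I x}
    (hu : ContMDiff I I.tangent ∞ (fun x => (⟨x, u x⟩ : TangentBundle I M))) :
    Continuous (divergence I u) := by
  rw [continuous_iff_continuousAt]
  intro x
  have h : ContinuousOn (divergence I u) (extChartAt I x).source :=
    ((continuousOn_chartDivergence hu).comp (continuousOn_extChartAt x)
      fun _ hp => (extChartAt I x).map_source hp).congr
      fun p hp => divergence_eq_chartDivergence hp hu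
  exact h.continuousAt (extChartAt_source_mem_nhds x)

end Divergence

/-! ### The Riemannian volume in a chart -/

section Volume

variable {n : ℕ} {H : Type*} [TopologicalSpace H]
  {I : ModelWithCorners ℝ (EuclideanSpace ℝ (Fin n)) H}
  {M : Type*} [TopologicalSpace M] [ChartedSpace H M]

theorem measurableSet_target (x₀ : M) : MeasurableSet (extChartAt I x₀).target := by
  rw [extChartAt_target]
  exact ((chartAt H x₀).open_target.preimage I.continuous_symm).measurableSet.inter
    I.isClosed_range.measurableSet

variable [MeasurableSpace M] [BorelSpace M]

theorem measurableSet_source (x₀ : M) : MeasurableSet (extChartAt I x₀).source :=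
  (isOpen_extChartAt_source x₀).measurableSet

theorem measurableSet_target_inter_preimage (x₀ : M) {A : Set M} (hA : MeasurableSet A) :
    MeasurableSet ((extChartAt I x₀).target ∩ (extChartAt I x₀).symm ⁻¹' A) := by
  have h := (continuousOn_iff_continuous_domRestrict.1
    (continuousOn_extChartAt_symm (I := I) x₀)).measurable hA
  have h2 := (measurableSet_target (I := I) x₀).subtype_image h
  rwa [Set.domRestrict_eq, preimage_comp, Subtype.image_preimage_coe] at h2

variable [Bundle.RiemannianBundle (fun x : M => TangentSpace I x)]

theorem aemeasurable_extChartAt_symm (x₀ : M) :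
    AEMeasurable (extChartAt I x₀).symm
      ((volume.restrict (extChartAt I x₀).target).withDensity
        (fun y => ENNReal.ofReal √(metricMatrix I x₀ y).det)) :=
  ((continuousOn_extChartAt_symm x₀).aemeasurable (measurableSet_target x₀)).mono_ac
    (withDensity_absolutelyContinuous _ _)

theorem chartVolume_apply (x₀ : M) {A : Set M} (hA : MeasurableSet A) :
    chartVolume I x₀ A =
      ∫⁻ y in (extChartAt I x₀).target ∩ (extChartAt I x₀).symm ⁻¹' A,
        ENNReal.ofReal √(metricMatrix I x₀ y).det := by
  rw [chartVolume, Measure.map_apply_of_aemeasurable (aemeasurable_extChartAt_symm x₀) hA,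
    withDensity_apply', Measure.restrict_restrict' (measurableSet_target x₀), inter_comm]

theorem chartVolume_compl_source (x₀ : M) :
    chartVolume I x₀ (extChartAt I x₀).sourceᶜ = 0 := by
  rw [chartVolume_apply x₀ (measurableSet_source x₀).compl]
  have : (extChartAt I x₀).target ∩ (extChartAt I x₀).symm ⁻¹' (extChartAt I x₀).sourceᶜ = ∅ :=
    eq_empty_of_forall_notMem fun y hy => hy.2 ((extChartAt I x₀).map_target hy.1)
  rw [this, Measure.restrict_empty, lintegral_zero_measure]

variable [IsManifold I ∞ M]

/-- The Riemannian volumes of two chart domains agree on the overlap. -/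
theorem chartVolume_inter_source (x₀ x₁ : M) {A : Set M} (hA : MeasurableSet A) :
    chartVolume I x₁ (A ∩ (extChartAt I x₀).source) =
      chartVolume I x₀ (A ∩ (extChartAt I x₁).source) := by
  rw [chartVolume_apply x₁ (hA.inter (measurableSet_source x₀)),
    chartVolume_apply x₀ (hA.inter (measurableSet_source x₁))]
  set V₀ := (extChartAt I x₀).target ∩
    (extChartAt I x₀).symm ⁻¹' (A ∩ (extChartAt I x₁).source) with hV₀
  have hV₀m : MeasurableSet V₀ :=
    measurableSet_target_inter_preimage x₀ (hA.inter (measurableSet_source x₁))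
  have hV₀o : ∀ y ∈ V₀, y ∈ overlap I x₀ x₁ := fun y hy => ⟨hy.1, hy.2.2⟩
  have himg : (extChartAt I x₁).target ∩
      (extChartAt I x₁).symm ⁻¹' (A ∩ (extChartAt I x₀).source) =
      transition I x₀ x₁ '' V₀ := by
    ext z
    constructor
    · rintro ⟨hz, hzA, hzS⟩
      refine ⟨extChartAt I x₀ ((extChartAt I x₁).symm z),
        ⟨(extChartAt I x₀).map_source hzS, ?_⟩, ?_⟩
      · rw [mem_preimage, (extChartAt I x₀).left_inv hzS]
        exact ⟨hzA, (extChartAt I x₁).map_target hz⟩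
      · rw [transition, Function.comp_apply, (extChartAt I x₀).left_inv hzS,
          (extChartAt I x₁).right_inv hz]
    · rintro ⟨y, ⟨hy, hyA, hyS⟩, rfl⟩
      refine ⟨(extChartAt I x₁).map_source hyS, ?_⟩
      rw [mem_preimage, transition, Function.comp_apply, (extChartAt I x₁).left_inv hyS]
      exact ⟨hyA, (extChartAt I x₀).map_target hy⟩
  have hinj : InjOn (transition I x₀ x₁) V₀ := by
    intro y hy z hz hyz
    exact (extChartAt I x₀).symm.injOn hy.1 hz.1
      ((extChartAt I x₁).injOn hy.2.2 hz.2.2 hyz)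
  rw [himg, lintegral_image_eq_lintegral_abs_det_fderiv_mul volume hV₀m
    (fun y hy => ((contDiffWithinAt_transition (hV₀o y hy)).differentiableWithinAt
      (by simp)).hasFDerivWithinAt.mono fun z hz => extChartAt_target_subset_range x₀ hz.1) hinj]
  refine setLIntegral_congr_fun hV₀m fun y hy => ?_
  rw [det_metricMatrix_transition (hV₀o y hy), Real.sqrt_mul (sq_nonneg _), Real.sqrt_sq_eq_abs,
    ENNReal.ofReal_mul (abs_nonneg _)]

/-- On a chart domain the Riemannian volume is given by the density `√(det g)`. -/
theorem riemannianVolume_restrict_source (x₀ : M) :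
    (riemannianVolume I M).restrict (extChartAt I x₀).source = chartVolume I x₀ := by
  have hS := measurableSet_source (I := I) x₀
  have hself : (chartVolume I x₀).restrict (extChartAt I x₀).source = chartVolume I x₀ :=
    Measure.restrict_eq_self_of_ae_mem (by
      rw [ae_iff]; exact chartVolume_compl_source x₀)
  have hle : ∀ x, chartVolume I x ≤ riemannianVolume I M := fun x => le_iSup (chartVolume I) x
  refine le_antisymm ?_ ?_
  -- Each chart volume is split along the chart domain of `x₀`: inside, agreement on overlaps bounds
  -- it by `chartVolume I x₀`. The second summand disappears on restriction to the domain.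
  · have h : riemannianVolume I M ≤ chartVolume I x₀ +
        (riemannianVolume I M).restrict (extChartAt I x₀).sourceᶜ := by
      refine iSup_le fun x => Measure.le_iff.2 fun A hA => ?_
      rw [← measure_inter_add_sdiff A hS, Measure.add_apply, chartVolume_inter_source x₀ x hA,
        Measure.restrict_apply hA]
      exact add_le_add (measure_mono inter_subset_left) (hle x _)
    refine (Measure.restrict_mono subset_rfl h).trans ?_
    rw [Measure.restrict_add, hself, Measure.restrict_restrict hS, inter_compl_self,
      Measure.restrict_empty, add_zero]
  · calc chartVolume I x₀ = (chartVolume I x₀).restrict (extChartAt I x₀).source := hself.symm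
      _ ≤ _ := Measure.restrict_mono subset_rfl (hle x₀)

variable [IsContMDiffRiemannianBundle I ∞ (EuclideanSpace ℝ (Fin n))
  (fun x : M => TangentSpace I x)]

/-- The integral of a continuous function that vanishes outside a chart domain. -/
theorem integral_riemannianVolume_eq (x₀ : M) {f : M → ℝ} (hf : Continuous f)
    (hf0 : ∀ p ∉ (extChartAt I x₀).source, f p = 0) :
    ∫ p, f p ∂(riemannianVolume I M) =
      ∫ y in (extChartAt I x₀).target,
        Real.exp (logDensity I x₀ y) * f ((extChartAt I x₀).symm y) := by
  have hdens : AEMeasurable (fun y => ENNReal.ofReal √(metricMatrix I x₀ y).det)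
      (volume.restrict (extChartAt I x₀).target) :=
    ENNReal.measurable_ofReal.comp_aemeasurable
      ((contDiffOn_det_metricMatrix x₀).continuousOn.sqrt.aemeasurable (measurableSet_target x₀))
  rw [← setIntegral_eq_integral_of_forall_compl_eq_zero hf0, riemannianVolume_restrict_source,
    chartVolume, integral_map (aemeasurable_extChartAt_symm x₀) hf.aestronglyMeasurable,
    integral_withDensity_eq_integral_toReal_smul₀ hdens
      (Filter.Eventually.of_forall fun _ => ENNReal.ofReal_lt_top)]
  refine setIntegral_congr_fun (measurableSet_target x₀) fun y hy => ?_
  rw [ENNReal.toReal_ofReal (Real.sqrt_nonneg _), sqrt_det_eq_exp hy, smul_eq_mul]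

end Volume

/-! ### The boundary in coordinates -/

section Boundary

variable {n : ℕ} {H : Type*} [TopologicalSpace H]
  {I : ModelWithCorners ℝ (EuclideanSpace ℝ (Fin n)) H}
  {M : Type*} [TopologicalSpace M] [ChartedSpace H M] [IsManifold I ∞ M]

/-- A vector tangent to the boundary has no normal component in any chart. -/
theorem IsTangentToBoundary.apply_chartDeriv_eq_zero {l : EuclideanSpace ℝ (Fin n) →L[ℝ] ℝ}
    (hI : range I = {y | 0 ≤ l y}) {x₀ p : M} (hp : p ∈ (extChartAt I x₀).source)
    (hlp : l (extChartAt I x₀ p) = 0) {v : TangentSpace I p} (hv : IsTangentToBoundary I p v) :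
    l (chartDeriv I x₀ p v) = 0 := by
  obtain ⟨γ, -, hd, he⟩ := hv
  cases he
  have hp' : γ 0 ∈ (chartAt H x₀).source := by rwa [extChartAt_source] at hp
  have h1 := ((mdifferentiableAt_extChartAt (I := I) hp').hasMFDerivAt.comp (0 : ℝ)
    hd.hasMFDerivAt).hasFDerivAt
  have h2 := (l.hasFDerivAt.comp (0 : ℝ) h1).hasDerivAt
  -- The curve stays in the half-space `0 ≤ l` and touches `l = 0` at time `0`, so the derivative of
  -- this function, the normal component of the velocity, vanishes.
  have hmin : IsLocalMin (l ∘ (extChartAt I x₀ ∘ γ)) 0 := by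
    refine Filter.Eventually.of_forall fun t => ?_
    simp only [Function.comp_apply, hlp]
    have : extChartAt I x₀ (γ t) ∈ range I := by
      rw [extChartAt_coe]; exact mem_range_self _
    rwa [hI] at this
  exact hmin.hasDerivAt_eq_zero h2

/-- A nonzero linear functional has no local minimum, so a point of the half-space with `l = 0`
cannot be interior to the chart target. -/
theorem mem_boundary_of_apply_eq_zero {l : EuclideanSpace ℝ (Fin n) →L[ℝ] ℝ} (hl : l ≠ 0)
    (hI : range I = {y | 0 ≤ l y}) {x₀ p : M} (hp : p ∈ (extChartAt I x₀).source)
    (hlp : l (extChartAt I x₀ p) = 0) : p ∈ I.boundary M := by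
  have hp' : p ∈ (chartAt H x₀).source := by rwa [extChartAt_source] at hp
  refine (I.isBoundaryPoint_iff_of_mem_atlas (n := ∞) (by simp) (chart_mem_atlas H x₀) hp').2 ?_
  refine ⟨subset_closure ((extChartAt I x₀).map_source hp), fun hint => hl ?_⟩
  have hmin : IsLocalMin l (extChartAt I x₀ p) := by
    filter_upwards [mem_interior_iff_mem_nhds.1 hint] with z hz
    rw [hlp]
    have : z ∈ range I := extChartAt_target_subset_range x₀ hz
    rwa [hI] at this
  have := hmin.fderiv_eq_zero
  rwa [l.fderiv] at this

end Boundary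

/-! ### From charts to the manifold -/

section Global

variable {n : ℕ} {H : Type*} [TopologicalSpace H]
  {I : ModelWithCorners ℝ (EuclideanSpace ℝ (Fin n)) H}
  {M : Type*} [TopologicalSpace M] [ChartedSpace H M] [IsManifold I ∞ M]
  [Bundle.RiemannianBundle (fun x : M => TangentSpace I x)]
  [IsContMDiffRiemannianBundle I ∞ (EuclideanSpace ℝ (Fin n)) (fun x : M => TangentSpace I x)]

theorem divergence_eq_zero_of_notMem {K : Set M} (hK : IsClosed K)
    {w : ∀ x : M, TangentSpace I x} (hw : ∀ p ∉ K, w p = 0) {p : M} (hp : p ∉ K) :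
    divergence I w p = 0 := by
  rw [divergence_eq_chartDivergence_self, chartDivergence]
  have hc : ContinuousAt (extChartAt I p).symm (extChartAt I p p) := continuousAt_extChartAt_symm p
  have hsymm : (extChartAt I p).symm (extChartAt I p p) = p := extChartAt_to_inv p
  have hnhds : (extChartAt I p).symm ⁻¹' Kᶜ ∈ 𝓝 (extChartAt I p p) :=
    hc (hK.isOpen_compl.mem_nhds (by rw [hsymm]; exact hp))
  have h0 : ∀ z, (extChartAt I p).symm z ∈ Kᶜ → fieldCoord I p w z = 0 := fun z hz => by
    rw [fieldCoord, hw _ hz, map_zero]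
  have hev : fieldCoord I p w =ᶠ[𝓝[range I] (extChartAt I p p)] fun _ => 0 :=
    Filter.mem_of_superset (nhdsWithin_le_nhds hnhds) fun z hz => h0 z hz
  have h1 := h0 (extChartAt I p p) (by rw [hsymm]; exact hp)
  rw [hev.fderivWithin_eq h1, h1]
  simp

theorem divergence_finset_sum {ι : Type*} (t : Finset ι) {u : ∀ x : M, TangentSpace I x}
    {w : ι → ∀ x : M, TangentSpace I x}
    (hw : ∀ i ∈ t, ContMDiff I I.tangent ∞ (fun x => (⟨x, w i x⟩ : TangentBundle I M)))
    (hu : ∀ x, u x = ∑ i ∈ t, w i x) (x : M) :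
    divergence I u x = ∑ i ∈ t, divergence I (w i) x := by
  have hf : fieldCoord I x u = fun y => ∑ i ∈ t, fieldCoord I x (w i) y := by
    ext1 y
    simp only [fieldCoord, hu, map_sum]
  have hx := mem_extChartAt_target (I := I) x
  have hd : fderivWithin ℝ (fieldCoord I x u) (range I) (extChartAt I x x) =
      ∑ i ∈ t, fderivWithin ℝ (fieldCoord I x (w i)) (range I) (extChartAt I x x) := by
    rw [hf]
    exact fderivWithin_fun_sum (I.uniqueDiffOn _ (extChartAt_target_subset_range x hx))
      fun i hi => differentiableWithinAt_of_contDiffOn_target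
        (contDiffOn_fieldCoord (hw i hi).contMDiffOn) hx
  simp only [divergence_eq_chartDivergence_self, chartDivergence]
  rw [hd, hf, map_sum, map_sum, Finset.sum_add_distrib]

variable [MeasurableSpace M] [BorelSpace M]

/-- The divergence theorem for a vector field supported in a chart domain. -/
theorem integral_divergence_eq_zero_of_support (hI : IsBoundaryModel I) (x₀ : M) {K : Set M}
    (hKc : IsCompact K) (hKcl : IsClosed K) (hKs : K ⊆ (extChartAt I x₀).source)
    {w : ∀ x : M, TangentSpace I x}
    (hws : ContMDiff I I.tangent ∞ (fun x => (⟨x, w x⟩ : TangentBundle I M)))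
    (hw : ∀ p ∉ K, w p = 0)
    (hb : ∀ l : EuclideanSpace ℝ (Fin n) →L[ℝ] ℝ, l ≠ 0 → range I = {y | 0 ≤ l y} →
      ∀ p ∈ (extChartAt I x₀).source, l (extChartAt I x₀ p) = 0 →
        l (chartDeriv I x₀ p (w p)) = 0) :
    ∫ p, divergence I w p ∂(riemannianVolume I M) = 0 := by
  rw [integral_riemannianVolume_eq x₀ (continuous_divergence hws)
    fun p hp => divergence_eq_zero_of_notMem hKcl hw fun h => hp (hKs h)]
  set T := (extChartAt I x₀).target with hT
  set K' := extChartAt I x₀ '' K with hK'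
  have hK'c : IsCompact K' := hKc.image_of_continuousOn ((continuousOn_extChartAt x₀).mono hKs)
  let X₀ : EuclideanSpace ℝ (Fin n) → EuclideanSpace ℝ (Fin n) :=
    fun z => Real.exp (logDensity I x₀ z) • fieldCoord I x₀ w z
  -- Extension of `√(det g) w` by zero. It is `C¹` within `range I` because the support lies in the
  -- compact set `K' ⊆ T`.
  let X := T.indicator X₀
  have hXT : ∀ y ∈ T, X y = X₀ y := fun y hy => indicator_of_mem hy _
  have hXK : ∀ y, y ∉ K' → X y = 0 := fun y hy => by
    by_cases hyT : y ∈ T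
    · rw [hXT y hyT]
      have : (extChartAt I x₀).symm y ∉ K := fun h =>
        hy ⟨_, h, (extChartAt I x₀).right_inv hyT⟩
      simp only [X₀, fieldCoord, hw _ this, map_zero, smul_zero]
    · exact indicator_of_notMem hyT _
  have hK'T : K' ⊆ T := by
    rintro _ ⟨p, hp, rfl⟩
    exact (extChartAt I x₀).map_source (hKs hp)
  have hevT : ∀ y ∈ T, X =ᶠ[𝓝[range I] y] X₀ := fun y hy =>
    Filter.mem_of_superset (target_mem_nhdsWithin hy) hXT
  have hevK : ∀ y, y ∉ T → X =ᶠ[𝓝[range I] y] fun _ => 0 := fun y hy =>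
    Filter.mem_of_superset
      (nhdsWithin_le_nhds (hK'c.isClosed.isOpen_compl.mem_nhds fun h => hy (hK'T h))) hXK
  have hX₀ : ContDiffOn ℝ ∞ X₀ T :=
    (contDiffOn_logDensity x₀).exp.smul (contDiffOn_fieldCoord hws.contMDiffOn)
  have hX : ContDiffOn ℝ 1 X (range I) := by
    intro y _
    by_cases hyT : y ∈ T
    · exact (((hX₀ y hyT).mono_of_mem_nhdsWithin (target_mem_nhdsWithin hyT)).of_le
        (by simp)).congr_of_eventuallyEq (hevT y hyT) (hXT y hyT)
    · exact contDiffWithinAt_const.congr_of_eventuallyEq (hevK y hyT)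
        (hXK y fun h => hyT (hK'T h))
  have hint : ∫ y in T, Real.exp (logDensity I x₀ y) *
        divergence I w ((extChartAt I x₀).symm y) =
      ∫ y in range I, traceCLM _ (fderivWithin ℝ X (range I) y) := by
    rw [setIntegral_eq_of_subset_of_forall_sdiff_eq_zero (s := T)
      (f := fun y => traceCLM _ (fderivWithin ℝ X (range I) y))
      I.isClosed_range.measurableSet (extChartAt_target_subset_range x₀)]
    · refine setIntegral_congr_fun (measurableSet_target x₀) fun y hy => ?_
      rw [(hevT y hy).fderivWithin_eq (hXT y hy),
        divergence_eq_chartDivergence ((extChartAt I x₀).map_target hy) hws,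
        (extChartAt I x₀).right_inv hy]
      exact (trace_fderivWithin_sqrt_det_smul hws hy).symm
    · intro y hy
      rw [(hevK y hy.2).fderivWithin_eq (hXK y fun h => hy.2 (hK'T h))]
      simp
  rw [hint]
  rcases hI with hI | ⟨l, hl, hI⟩
  · rw [hI] at hX ⊢
    rw [contDiffOn_univ] at hX
    simp only [fderivWithin_univ, Measure.restrict_univ]
    exact integral_trace_fderiv_eq_zero hX (HasCompactSupport.intro hK'c hXK)
  · have hbX : ∀ y, l y = 0 → l (X y) = 0 := fun y hy => by
      by_cases hyT : y ∈ T
      · rw [hXT y hyT]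
        simp only [X₀, map_smul]
        have := hb l hl hI _ ((extChartAt I x₀).map_target hyT)
          (by rw [(extChartAt I x₀).right_inv hyT]; exact hy)
        rw [fieldCoord, this, smul_zero]
      · rw [show X y = 0 from indicator_of_notMem hyT _, map_zero]
    rw [hI] at hX ⊢
    exact setIntegral_halfSpace_trace_fderivWithin_eq_zero hl hX hK'c hXK hbX

variable [T2Space M] [CompactSpace M]

/-- **The divergence theorem** on a compact Riemannian manifold with boundary, for a vector field
tangent to the boundary. -/
theorem integral_divergence_eq_zero (hI : IsBoundaryModel I)
    (hint : ∀ f : M → ℝ, Continuous f → Integrable f (riemannianVolume I M))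
    {u : ∀ x : M, TangentSpace I x}
    (hu : ContMDiff I I.tangent ∞ (fun x => (⟨x, u x⟩ : TangentBundle I M)))
    (hb : ∀ x ∈ I.boundary M, IsTangentToBoundary I x (u x)) :
    ∫ p, divergence I u p ∂(riemannianVolume I M) = 0 := by
  obtain ⟨f, hf⟩ := SmoothPartitionOfUnity.exists_isSubordinate_chartAt_source I M
  have hfin := f.locallyFinite.finite_nonempty_of_compact
  let t : Finset M := hfin.toFinset
  have hsum : ∀ x, ∑ i ∈ t, f i x = 1 := fun x => by
    refine f.sum_finsupport' x (mem_univ x) fun i hi => ?_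
    rw [SmoothPartitionOfUnity.mem_finsupport] at hi
    exact hfin.mem_toFinset.2 ⟨x, hi⟩
  have hws : ∀ i, ContMDiff I I.tangent ∞
      (fun x => (⟨x, f i x • u x⟩ : TangentBundle I M)) := fun i =>
    (f i).contMDiff.smul_section hu
  have hdiv := divergence_finset_sum (I := I) t (u := u) (w := fun i x => f i x • u x)
    (fun i _ => hws i) fun x => by rw [← Finset.sum_smul, hsum, one_smul]
  simp only [hdiv]
  rw [integral_finsetSum _ fun i _ => hint _ (continuous_divergence (hws i))]
  refine Finset.sum_eq_zero fun i _ => ?_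
  refine integral_divergence_eq_zero_of_support hI i (K := tsupport (f i))
    (isClosed_tsupport _).isCompact (isClosed_tsupport _)
    (by rw [extChartAt_source]; exact hf i) (hws i) (fun p hp => ?_) fun l hl hIl p hp hlp => ?_
  · rw [image_eq_zero_of_notMem_tsupport hp, zero_smul]
  · rw [map_smul, map_smul, (hb p (mem_boundary_of_apply_eq_zero hl hIl hp
      hlp)).apply_chartDeriv_eq_zero hIl hp hlp, smul_zero]

end Global

end

end MoserFlow

/-! ### Conservation of total mass -/

theorem mainTheorem5 {n : ℕ} {H : Type*} [TopologicalSpace H]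
    (I : ModelWithCorners ℝ (EuclideanSpace ℝ (Fin n)) H) (hI : MoserFlow.IsBoundaryModel I)
    {M : Type*} [TopologicalSpace M] [T2Space M] [CompactSpace M]
    [ChartedSpace H M] [IsManifold I ∞ M]
    [Bundle.RiemannianBundle (fun x : M => TangentSpace I x)]
    [IsContMDiffRiemannianBundle I ∞ (EuclideanSpace ℝ (Fin n)) (fun x : M => TangentSpace I x)]
    [MeasurableSpace M] [BorelSpace M]
    (ν : M → ℝ) (hν_cont : Continuous ν) (hν_pos : ∀ x, 0 < ν x)
    (hν_int : ∫ x, ν x ∂(MoserFlow.riemannianVolume I M) = 1)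
    (u : ∀ x : M, TangentSpace I x)
    (hu : ContMDiff I I.tangent ∞ (fun x => (⟨x, u x⟩ : TangentBundle I M)))
    (h : I.boundary M = ∅ ∨ ∀ x ∈ I.boundary M, MoserFlow.IsTangentToBoundary I x (u x)) :
    ∫ x, (ν x - MoserFlow.divergence I u x) ∂(MoserFlow.riemannianVolume I M) = 1 := by
  -- The Bochner integral of a non-integrable function is `0` by convention, whereas that of `ν` is
  -- `1`.
  have hν : Integrable ν (MoserFlow.riemannianVolume I M) := by
    by_contra h0
    rw [integral_undef h0] at hν_int
    exact zero_ne_one hν_int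
  -- On compact `M` the quotient `f / ν` is bounded, so `|f| ≤ C ν`. Thus integrability comes from
  -- that of `ν`, with no separate proof that the volume is finite.
  have hint : ∀ f : M → ℝ, Continuous f → Integrable f (MoserFlow.riemannianVolume I M) := by
    intro f hf
    obtain ⟨C, hC⟩ := isCompact_univ.exists_bound_of_continuousOn
      (hf.div hν_cont fun x => (hν_pos x).ne').continuousOn
    refine (hν.const_mul C).mono' hf.aestronglyMeasurable (Filter.Eventually.of_forall fun x => ?_)
    have h1 := hC x (mem_univ x)
    rwa [Pi.div_apply, norm_div, Real.norm_of_nonneg (hν_pos x).le, div_le_iff₀ (hν_pos x)] at h1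
  have hb : ∀ x ∈ I.boundary M, MoserFlow.IsTangentToBoundary I x (u x) := by
    rcases h with h | h
    · simp [h]
    · exact h
  rw [integral_sub hν (hint _ (MoserFlow.continuous_divergence hu)), hν_int,
    MoserFlow.integral_divergence_eq_zero hI hint hu hb, sub_zero]
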